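/- **Conventions.** Compact spaces are Hausdorff. Let $K$ be a finite (abstract) simplicial complex with vertices $0,\dots,k$. A $(k+1)$-tuple $\mathcal A=(A_0,\dots,A_k)$ of subsets of a space $X$ is a *$K$-tuple* if every non-empty $I\subset\{0,\dots,k\}$ with $\bigcap_{i\in I}A_i\neq\emptyset$ is a simplex of $K$; it is open (closed) if all $A_i$ are open (closed). A *$K$-neighbourhood* of a tuple $\mathcal B$ is an open $K$-tuple $\mathcal U$ with $B_i\subset U_i$ for all $i$; we write $\bigcup\mathcal U=\bigcup_i U_i$. The dimension $K\text{-}\mathrm{Ind}\,X\in\{-1\}\cup\mathrm{Ordinals}\cup\{\infty\}$ is $-1$ iff $X=\emptyset$; for an ordinal $\alpha$, $K\text{-}\mathrm{Ind}\,X\le\alpha$ iff every closed $K$-tuple of $X$ has a $K$-neighbourhood $\mathcal U$ with $K\text{-}\mathrm{Ind}(X\setminus\bigcup\mathcal U)<\alpha$; and for $X\ne\emptyset$, $K\text{-}\mathrm{Ind}\,X$ is the least ordinal $\alpha$ with $K\text{-}\mathrm{Ind}\,X\le\alpha$, or $\infty$ if there is none ($\infty+1=\infty$). For an open $K$-tuple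 $\mathcal U$ let $\mathrm{obs}_K\,\mathcal U$ be the set of points $x$ such that no $K$-neighbourhood $\mathcal V$ of $\mathcal U$ has $x\in\bigcup\mathcal V$. The *strength degree* $\mathrm{str}_K X$ is $1$ if $0<K\text{-}\mathrm{Ind}\,X<\infty$ and some closed $K$-tuple of $X$ has no $K$-neighbourhood $\mathcal U$ with both $\mathrm{obs}_K\,\mathcal U=\emptyset$ and $K\text{-}\mathrm{Ind}(X\setminus\bigcup\mathcal U)<K\text{-}\mathrm{Ind}\,X$; otherwise $\mathrm{str}_K X=0$. For $k\ge1$, $\partial\Delta^k$ is the complex of all non-empty proper subsets of $\{0,\dots,k\}$. Let $X,Y$ be non-empty compact spaces, and let $\mathcal S_X$ be the family of all subsets of $X$ that are finite or homeomorphic to the one-point compactification of a countably infinite discrete space. Let $\mathfrak m\ge\max\{\aleph_0,(wX)^+,(wY)^+,|\mathcal S_X|\}$, where $w$ denotes weight, let $A=D\cup\{\mu\}$ be the one-point compactification of a discrete space $D$ of cardinality $\mathfrak m$, and let $\varphi\colon D\to\mathcal S_X$ be any function with $|\varphi^{-1}(S)|=\mathfrak m$ for every $S\in\mathcal S_X$.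 Let $\pi_1$ be the quotient map of $A\times X\times Y$ that collapses each set $\{\mu\}\times\{x\}\times Y$, $x\in X$, to a point. Then $Z(X,Y)$ is the subspace $\pi_1(\{\mu\}\times X\times Y)\cup\bigcup_{\alpha\in D}\pi_1(\{\alpha\}\times\varphi(\alpha)\times Y)$ of the quotient space. **Theorem.** For all non-empty compact spaces $X,Y$, every choice of $\mathfrak m$ and $\varphi$ as above, and every finite simplicial complex $K$: 1. $K\text{-}\mathrm{Ind}\,Z(X,Y)\le\max\{K\text{-}\mathrm{Ind}\,X+1,\;K\text{-}\mathrm{Ind}\,Y\}$. 2. If $\mathrm{str}_K X=0$, then $K\text{-}\mathrm{Ind}\,Z(X,Y)=\max\{K\text{-}\mathrm{Ind}\,X,\;K\text{-}\mathrm{Ind}\,Y\}$. 3. If $k\ge2$ and $\partial\Delta^k\text{-}\mathrm{Ind}\,Y<\partial\Delta^k\text{-}\mathrm{Ind}\,X+1=\partial\Delta^k\text{-}\mathrm{Ind}\,Z(X,Y)$, then $\mathrm{str}_{\partial\Delta^k}Z(X,Y)=0$. -/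

import Mathlib

open Set Cardinal

universe u

noncomputable section

namespace Fedorchuk

/-! ### Tuples modulo a finite simplicial complex with vertices `0, …, k` -/

section Tuples

variable {k : ℕ} (K : AbstractSimplicialComplex (Fin (k + 1)))
variable {X : Type u} [TopologicalSpace X]

/-- A `(k+1)`-tuple of subsets is a `K`-tuple if every non-empty set of indices whose members
have a common point is a face of `K`. -/
def IsKTuple (A : Fin (k + 1) → Set X) : Prop :=
  ∀ I : Finset (Fin (k + 1)), I.Nonempty → (⋂ i ∈ I, A i).Nonempty → I ∈ K.faces

/-- Closed `K`-tuples. -/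
def IsClosedKTuple (F : Fin (k + 1) → Set X) : Prop :=
  (∀ i, IsClosed (F i)) ∧ IsKTuple K F

/-- Open `K`-tuples. -/
def IsOpenKTuple (U : Fin (k + 1) → Set X) : Prop :=
  (∀ i, IsOpen (U i)) ∧ IsKTuple K U

/-- `U` is a `K`-neighbourhood of the tuple `B`. -/
def IsKNhd (U B : Fin (k + 1) → Set X) : Prop :=
  IsOpenKTuple K U ∧ ∀ i, B i ⊆ U i

/-- The partition `X \ ⋃ U` corresponding to an (open `K`-)tuple `U`. -/
def partition (U : Fin (k + 1) → Set X) : Set X := (⋃ i, U i)ᶜ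

/-- The set of `K`-obstruction points for `U`: the points not covered by any
`K`-neighbourhood of `U`. -/
def dObs (U : Fin (k + 1) → Set X) : Set X :=
  {x | ¬ ∃ V : Fin (k + 1) → Set X, IsKNhd K V U ∧ x ∈ ⋃ i, V i}

end Tuples

/-! ### The transfinite dimension `K`-Ind and the strength degree -/

/-- `K`-Ind `X ≤ α`, for an ordinal `α`: every closed `K`-tuple of `X` has a `K`-partition `P`
that is empty or satisfies `K`-Ind `P ≤ β` for some ordinal `β < α`. -/
def KIndLE {k : ℕ} (K : AbstractSimplicialComplex (Fin (k + 1))) (α : Ordinal.{u})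
    (X : Type u) [TopologicalSpace X] : Prop :=
  ∀ F : Fin (k + 1) → Set X, IsClosedKTuple K F →
    ∃ U : Fin (k + 1) → Set X, IsKNhd K U F ∧
      (partition U = ∅ ∨ ∃ β : Ordinal.{u}, ∃ _ : β < α, KIndLE K β (partition U))
termination_by α

open Classical in
/-- The dimension `K`-Ind `X`, an ordinal, `-1` (represented by `⊥`) or `∞` (represented
by `⊤`). -/
def kInd {k : ℕ} (K : AbstractSimplicialComplex (Fin (k + 1)))
    (X : Type u) [TopologicalSpace X] : WithBot (WithTop Ordinal.{u}) :=
  if IsEmpty X then ⊥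
  else if ∃ α : Ordinal.{u}, KIndLE K α X then
    (((sInf {α : Ordinal.{u} | KIndLE K α X} : Ordinal.{u}) : WithTop Ordinal.{u}) :
      WithBot (WithTop Ordinal.{u}))
  else ⊤

open Classical in
/-- The dimensional strength degree: `1` if `0 < K`-Ind `X < ∞` and it is not the case that every
closed `K`-tuple has a `K`-neighbourhood `U` without obstruction points whose partition has
dimension smaller than `K`-Ind `X`; otherwise `0`. -/
def dstr {k : ℕ} (K : AbstractSimplicialComplex (Fin (k + 1)))
    (X : Type u) [TopologicalSpace X] : ℕ :=
  if 0 < kInd K X ∧ kInd K X < ⊤ ∧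
      ¬ ∀ F : Fin (k + 1) → Set X, IsClosedKTuple K F →
        ∃ U : Fin (k + 1) → Set X, IsKNhd K U F ∧ dObs K U = ∅ ∧
          kInd K (partition U) < kInd K X
  then 1 else 0

/-- `∂Δᵏ` for `k ≥ 1`: the complex of all proper faces of the simplex with vertices `0, …, k`,
that is, of all non-empty sets of at most `k` vertices. -/
def boundarySimplex (k : ℕ) (hk : 1 ≤ k) : AbstractSimplicialComplex (Fin (k + 1)) where
  faces := {s | s.Nonempty ∧ s.card ≤ k}
  isRelLowerSet_faces := fun _ hs =>
    ⟨hs.1, fun _ hts ht => ⟨ht, (Finset.card_le_card hts).trans hs.2⟩⟩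
  singleton_mem := fun v => ⟨Finset.singleton_nonempty v, by simpa using hk⟩

/-! ### The space `Z(X, Y)` -/

/-- The weight of a space: the least cardinality of a base of its topology. -/
def weight (X : Type u) [TopologicalSpace X] : Cardinal.{u} :=
  sInf {c | ∃ B : Set (Set X), TopologicalSpace.IsTopologicalBasis B ∧ #B = c}

/-- The family `𝒮_X` of all subsets of `X` that are finite or homeomorphic to the one-point
compactification of a countably infinite discrete space. -/
def smallSets (X : Type u) [TopologicalSpace X] : Set (Set X) :=
  {S | S.Finite ∨ Nonempty (S ≃ₜ OnePoint ℕ)}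

section Plank

variable (D X Y : Type u)

/-- The equivalence relation on `A × X × Y`, `A = D ∪ {μ}`, whose only non-trivial classes are
the sets `{μ} × {x} × Y`. -/
def plankSetoid : Setoid (OnePoint D × X × Y) where
  r p q := p = q ∨ (p.1 = OnePoint.infty ∧ q.1 = OnePoint.infty ∧ p.2.1 = q.2.1)
  iseqv :=
    { refl := fun _ => Or.inl rfl
      symm := by
        rintro p q (h | ⟨h₁, h₂, h₃⟩)
        · exact Or.inl h.symm
        · exact Or.inr ⟨h₂, h₁, h₃.symm⟩
      trans := by
        rintro p q r (rfl | ⟨h₁, h₂, h₃⟩) h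
        · exact h
        · rcases h with rfl | ⟨h₄, h₅, h₆⟩
          · exact Or.inr ⟨h₁, h₂, h₃⟩
          · exact Or.inr ⟨h₁, h₅, h₃.trans h₆⟩ }

/-- The quotient space `N` of `A × X × Y`. -/
abbrev PlankQuotient : Type u := Quotient (plankSetoid D X Y)

variable {D X}

/-- The sets `H(a)` for `a ∈ A = D ∪ {μ}`: the image in `N` of `{μ} × X × Y` if `a = μ`, and the
image of `{a} × φ(a) × Y` if `a ≠ μ`. -/
def plankSlice [TopologicalSpace X] (φ : D → smallSets X) (a : OnePoint D) :
    Set (PlankQuotient D X Y) :=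
  Quotient.mk (plankSetoid D X Y) ''
    {p | p.1 = a ∧ ∀ d : D, a = (d : OnePoint D) → p.2.1 ∈ (φ d : Set X)}

/-- The space `Z(X, Y)`, as a subspace of the quotient `N`. -/
def zSpace [TopologicalSpace X] (φ : D → smallSets X) : Set (PlankQuotient D X Y) :=
  ⋃ a : OnePoint D, plankSlice Y φ a

end Plank

end Fedorchuk

end

/-!
`Z(X, Y)` is the disjoint union of a copy of `X`, over the point at infinity of `OnePoint D`, and of
open-and-closed pieces `φ d × Y` with `φ d` a zero-dimensional compact subset of `X`. The coordinate
in `X` is a continuous retraction onto the copy of `X`. The copies of `X` and `Y` give the lower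
bound for `K`-Ind `Z(X, Y)`.

For the upper bounds take a closed `K`-tuple `F` of `Z(X, Y)` and a `K`-neighbourhood `U` in `X` of
its trace on `X`. By compactness the preimage of `U` contains `F` over all but finitely many `d`
(`Plank.finite_exceptional`). On the exceptional pieces one may use any `K`-neighbourhood, since
the pieces are open-and-closed, and `K`-Ind `(φ d × Y) ≤ K`-Ind `Y` (`KIndLE.prod_left`).
If `U` has no obstruction points, then on every other piece the trace of `U` on `φ d` can be
enlarged to an open `K`-tuple that covers all of `φ d` (`exists_covering_of_dObs_eq_empty`), so that
these pieces do not meet the partition. The partition is thus the disjoint union of the partition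
in `X` and finitely many partitions in pieces (`Plank.kIndLT_partition_glue`), which bounds
its dimension (`Plank.kIndLE`). Strength degree `0` supplies such a `U` with a partition of
dimension less than `K`-Ind `X`. In general the interiors of a closed `K`-tuple that is a neighbourhood of
the given one (`exists_closed_swelling`) have no obstruction points, and their partition has
dimension at most `K`-Ind `X`, which costs the summand `1`.

For the last assertion, `K = ∂Δᵏ` with `k ≥ 2`, the neighbourhood in `Z(X, Y)` itself must be free
of obstruction points. An open tuple is a `K`-tuple if and only if every point misses one of its
members. Let `B` be a closed `K`-tuple that is a neighbourhood of `F`, and let `U` be formed by the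
interiors. Over the slices `φ d`, uncovered points near a point outside `B j` are added to the
member with index `j + 1`, indices taken modulo `k + 1`; this covers `φ d` (`exists_cyclic_covering`).
The same rule shows that every point of `X` can still be added to some member
(`Plank.exists_nhd_dObs_eq_empty`).
-/

namespace Fedorchuk

variable {k : ℕ} {K : AbstractSimplicialComplex (Fin (k + 1))}

/-! ### `K`-tuples -/

section Tuples

variable {X Y : Type u}

theorem isKTuple_iff {A : Fin (k + 1) → Set X} :
    IsKTuple K A ↔ ∀ x, ∀ I : Finset (Fin (k + 1)), I.Nonempty → (∀ i ∈ I, x ∈ A i) →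
      I ∈ K.faces := by
  constructor
  · intro h x I hI hx
    exact h I hI ⟨x, by simpa using hx⟩
  · rintro h I hI ⟨x, hx⟩
    exact h x I hI (by simpa using hx)

theorem mem_faces_of_subset {I J : Finset (Fin (k + 1))} (hJ : J ∈ K.faces) (hIJ : I ⊆ J)
    (hI : I.Nonempty) : I ∈ K.faces :=
  (K.isRelLowerSet_faces hJ).2 hIJ hI

theorem IsKTuple.mono {A B : Fin (k + 1) → Set X} (hB : IsKTuple K B) (h : ∀ i, A i ⊆ B i) :
    IsKTuple K A :=
  isKTuple_iff.2 fun x I hI hx => isKTuple_iff.1 hB x I hI fun i hi => h i (hx i hi)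

theorem IsKTuple.preimage {A : Fin (k + 1) → Set X} (hA : IsKTuple K A) (f : Y → X) :
    IsKTuple K fun i => f ⁻¹' A i := by
  rw [isKTuple_iff] at *
  exact fun y I hI hy => hA (f y) I hI hy

theorem mem_partition {U : Fin (k + 1) → Set X} {x : X} :
    x ∈ partition U ↔ ∀ i, x ∉ U i := by
  simp [partition]

variable [TopologicalSpace X] [TopologicalSpace Y]

theorem IsClosedKTuple.preimage {A : Fin (k + 1) → Set X} (hA : IsClosedKTuple K A) {f : Y → X}
    (hf : Continuous f) : IsClosedKTuple K fun i => f ⁻¹' A i :=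
  ⟨fun i => (hA.1 i).preimage hf, hA.2.preimage f⟩

theorem IsOpenKTuple.preimage {A : Fin (k + 1) → Set X} (hA : IsOpenKTuple K A) {f : Y → X}
    (hf : Continuous f) : IsOpenKTuple K fun i => f ⁻¹' A i :=
  ⟨fun i => (hA.1 i).preimage hf, hA.2.preimage f⟩

theorem isClosed_partition {U : Fin (k + 1) → Set X} (hU : ∀ i, IsOpen (U i)) :
    IsClosed (partition U) :=
  (isOpen_iUnion hU).isClosed_compl

/-- In a normal space every closed `K`-tuple has a closed `K`-tuple as a neighbourhood. The members
are enlarged one after another: `F i` is disjoint from each closed set `⋂ j ∈ J, F j` with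
`J ∪ {i}` not a face. -/
theorem exists_closed_swelling [NormalSpace X] {F : Fin (k + 1) → Set X}
    (hF : IsClosedKTuple K F) :
    ∃ B : Fin (k + 1) → Set X, IsClosedKTuple K B ∧ ∀ i, F i ⊆ interior (B i) := by
  classical
  suffices h : ∀ s : Finset (Fin (k + 1)), ∃ B : Fin (k + 1) → Set X, IsClosedKTuple K B ∧
      (∀ i, F i ⊆ B i) ∧ ∀ i ∈ s, F i ⊆ interior (B i) by
    obtain ⟨B, hB, -, h⟩ := h Finset.univ
    exact ⟨B, hB, fun i => h i (Finset.mem_univ i)⟩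
  intro s
  induction s using Finset.induction_on with
  | empty => exact ⟨F, hF, fun _ => subset_rfl, by simp⟩
  | insert a s ha ih =>
    obtain ⟨B, hB, hFB, hs⟩ := ih
    -- `N` is the union of the intersections that the enlarged member `a` has to avoid.
    set N : Set X := ⋃ J ∈ {J : Finset (Fin (k + 1)) | insert a J ∉ K.faces}, ⋂ j ∈ J, B j with hN
    have hNc : IsClosed N :=
      (Set.toFinite _).isClosed_biUnion fun J _ => isClosed_biInter fun j _ => hB.1 j
    have hd : B a ⊆ Nᶜ := by
      intro x hx hxN
      simp only [hN, mem_iUnion, mem_ofPred_eq, mem_iInter] at hxN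
      obtain ⟨J, hJ, hxJ⟩ := hxN
      refine hJ (isKTuple_iff.1 hB.2 x _ (Finset.insert_nonempty a J) fun i hi => ?_)
      rcases Finset.mem_insert.1 hi with rfl | hi
      · exact hx
      · exact hxJ i hi
    obtain ⟨W, hW, hBW, hWN⟩ := normal_exists_closure_subset (hB.1 a) hNc.isOpen_compl hd
    refine ⟨Function.update B a (closure W), ⟨fun i => ?_, isKTuple_iff.2 fun x I hI hx => ?_⟩,
      fun i => ?_, fun i hi => ?_⟩
    · rcases eq_or_ne i a with rfl | h
      · simp
      · simpa [h] using hB.1 i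
    · by_cases haI : a ∈ I
      · by_contra hIK
        refine hWN (show x ∈ closure W by simpa using hx a haI) ?_
        simp only [hN, mem_iUnion, mem_ofPred_eq, mem_iInter]
        refine ⟨I.erase a, by rwa [Finset.insert_erase haI], fun j hj => ?_⟩
        have := hx j (Finset.mem_of_mem_erase hj)
        rwa [Function.update_of_ne (Finset.ne_of_mem_erase hj)] at this
      · refine isKTuple_iff.1 hB.2 x I hI fun i hi => ?_
        have := hx i hi
        rwa [Function.update_of_ne (ne_of_mem_of_not_mem hi haI)] at this
    · rcases eq_or_ne i a with rfl | h
      · simpa using (hFB i).trans (hBW.trans subset_closure)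
      · simpa [h] using hFB i
    · rcases eq_or_ne i a with rfl | h
      · simpa using (hFB i).trans (hBW.trans (interior_maximal subset_closure hW))
      · simpa [h] using hs i ((Finset.mem_insert.1 hi).resolve_left h)

/-! ### Obstruction points -/

/-- A point is not an obstruction point as soon as some neighbourhood of it can be added to some
member of the tuple. -/
theorem notMem_dObs {U : Fin (k + 1) → Set X} (hU : IsOpenKTuple K U) {x : X} {O : Set X}
    (hO : IsOpen O) (hx : x ∈ O) (i : Fin (k + 1))
    (h : ∀ w ∈ O, ∀ I : Finset (Fin (k + 1)), I.Nonempty → (∀ l ∈ I, w ∈ U l ∨ l = i) →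
      I ∈ K.faces) : x ∉ dObs K U := by
  simp only [dObs, mem_ofPred_eq, not_not]
  refine ⟨fun l => U l ∪ {w | w ∈ O ∧ l = i}, ⟨⟨fun l => ?_, isKTuple_iff.2 fun w I hI hw => ?_⟩,
    fun l => subset_union_left⟩, mem_iUnion.2 ⟨i, Or.inr ⟨hx, rfl⟩⟩⟩
  · refine (hU.1 l).union ?_
    by_cases hl : l = i <;> simp [hl, hO]
  · by_cases hwO : w ∈ O
    · exact h w hwO I hI fun l hl => (hw l hl).imp_right And.right
    · exact isKTuple_iff.1 hU.2 w I hI fun l hl => (hw l hl).resolve_right fun h' => hwO h'.1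

theorem exists_of_dObs_eq_empty {U : Fin (k + 1) → Set X} (h : dObs K U = ∅) (x : X) :
    ∃ V : Fin (k + 1) → Set X, IsKNhd K V U ∧ ∃ i, x ∈ V i := by
  by_contra hx
  have : x ∈ dObs K U := by simpa [dObs] using hx
  simp [h] at this

/-- If the members of `U` lie in those of a closed `K`-tuple `B` near `x`, then `x` is not an
obstruction point: the index to which a neighbourhood of `x` is added is one with `x ∈ B i`,
if there is any. -/
theorem notMem_dObs_of_subset_closed {U B : Fin (k + 1) → Set X} (hU : IsOpenKTuple K U)
    (hB : IsClosedKTuple K B) {x : X} {O : Set X} (hO : IsOpen O) (hx : x ∈ O)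
    (h : ∀ i, U i ∩ O ⊆ B i) : x ∉ dObs K U := by
  classical
  set J : Finset (Fin (k + 1)) := {j | x ∈ B j} with hJ
  obtain ⟨i, hi⟩ : ∃ i, J.Nonempty → i ∈ J := by
    rcases J.eq_empty_or_nonempty with h | ⟨i, hi⟩
    · exact ⟨0, by simp [h]⟩
    · exact ⟨i, fun _ => hi⟩
  refine notMem_dObs hU (O := O ∩ ⋂ j ∈ {j | x ∉ B j}, (B j)ᶜ)
    (hO.inter ((Set.toFinite _).isOpen_biInter fun j _ => (hB.1 j).isOpen_compl))
    ⟨hx, by simp⟩ i ?_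
  rintro w ⟨hwO, hw⟩ I hI hwI
  have hw' : ∀ l, w ∈ U l → l ∈ J := by
    intro l hl
    by_contra hlJ
    have hlB : x ∉ B l := by simpa [hJ] using hlJ
    exact (mem_iInter₂.1 hw l hlB) (h l ⟨hl, hwO⟩)
  rcases J.eq_empty_or_nonempty with hJe | hJn
  · have : I ⊆ {i} := fun l hl => by
      rcases hwI l hl with h' | h'
      · simpa [hJe] using hw' l h'
      · simpa using h'
    exact mem_faces_of_subset (K.singleton_mem i) this hI
  · have hJK : J ∈ K.faces := isKTuple_iff.1 hB.2 x J hJn fun i hi => by simpa [hJ] using hi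
    refine mem_faces_of_subset hJK (fun l hl => ?_) hI
    rcases hwI l hl with h' | rfl
    · exact hw' l h'
    · exact hi hJn

theorem dObs_eq_empty_of_partition {U : Fin (k + 1) → Set X} (hU : IsOpenKTuple K U)
    (h : partition U = ∅) : dObs K U = ∅ := by
  refine eq_empty_of_forall_notMem fun x hx => hx ⟨U, ⟨hU, fun _ => subset_rfl⟩, ?_⟩
  by_contra hx'
  have : x ∈ partition U := hx'
  simp [h] at this

end Tuples

/-! ### Monotonicity and sums for the dimension -/

section Dimension

/-- `K`-Ind `X < α`, for an ordinal `α`. -/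
def KIndLT (K : AbstractSimplicialComplex (Fin (k + 1))) (α : Ordinal.{u}) (X : Type u)
    [TopologicalSpace X] : Prop :=
  IsEmpty X ∨ ∃ β < α, KIndLE K β X

variable {X Y : Type u} [TopologicalSpace X] [TopologicalSpace Y]

theorem kIndLE_iff {α : Ordinal.{u}} : KIndLE K α X ↔
    ∀ F : Fin (k + 1) → Set X, IsClosedKTuple K F →
      ∃ U : Fin (k + 1) → Set X, IsKNhd K U F ∧ KIndLT K α (partition U) := by
  rw [KIndLE]
  simp only [KIndLT, isEmpty_coe_sort, exists_prop]

theorem KIndLT.mono {α β : Ordinal.{u}} (h : KIndLT K α X) (hαβ : α ≤ β) : KIndLT K β X :=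
  h.imp_right fun ⟨γ, hγ, h⟩ => ⟨γ, hγ.trans_le hαβ, h⟩

theorem KIndLE.mono {α β : Ordinal.{u}} (h : KIndLE K α X) (hαβ : α ≤ β) : KIndLE K β X := by
  rw [kIndLE_iff] at *
  intro F hF
  obtain ⟨U, hU, hUα⟩ := h F hF
  exact ⟨U, hU, hUα.mono hαβ⟩

theorem KIndLE.of_isEmpty [IsEmpty X] (α : Ordinal.{u}) : KIndLE K α X :=
  kIndLE_iff.2 fun F _ => ⟨F, ⟨⟨fun _ => by rw [Set.eq_empty_of_isEmpty (F _)]; exact isOpen_empty,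
    isKTuple_iff.2 fun x => isEmptyElim x⟩, fun _ => subset_rfl⟩, Or.inl inferInstance⟩

theorem kIndLT_succ {α : Ordinal.{u}} : KIndLT K (Order.succ α) X ↔ KIndLE K α X := by
  constructor
  · rintro (h | ⟨β, hβ, h⟩)
    · exact .of_isEmpty α
    · exact h.mono (Order.lt_succ_iff.1 hβ)
  · exact fun h => Or.inr ⟨α, Order.lt_succ α, h⟩

/-- Monotonicity for closed subspaces, given as continuous injections of compact spaces. -/
theorem KIndLE.of_injective {α : Ordinal.{u}} [CompactSpace Y] [T2Space X] [NormalSpace X]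
    {f : Y → X} (hf : Continuous f) (hi : f.Injective) (h : KIndLE K α X) : KIndLE K α Y := by
  induction α using WellFoundedLT.induction generalizing X Y with
  | ind α ih =>
  rw [kIndLE_iff] at *
  intro F hF
  have hfc := hf.isClosedEmbedding hi
  have hFK : IsKTuple K fun i => f '' F i := isKTuple_iff.2 fun x I hI hx => by
    obtain ⟨i, hiI⟩ := hI
    obtain ⟨y, -, rfl⟩ := hx i hiI
    exact isKTuple_iff.1 hF.2 y I ⟨i, hiI⟩ fun j hj => (hi.mem_set_image).1 (hx j hj)
  obtain ⟨U, hU, hUα⟩ := h (fun i => f '' F i) ⟨fun i => hfc.isClosedMap _ (hF.1 i), hFK⟩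
  refine ⟨fun i => f ⁻¹' U i, ⟨hU.1.preimage hf, fun i => image_subset_iff.1 (hU.2 i)⟩, ?_⟩
  set g : partition (fun i => f ⁻¹' U i) → partition U :=
    fun y => ⟨f y, by have := y.2; rw [mem_partition] at *; exact this⟩
  have hP := isClosed_partition hU.1.1
  have : CompactSpace (partition (fun i => f ⁻¹' U i)) :=
    isCompact_iff_compactSpace.1 (isClosed_partition fun i => (hU.1.1 i).preimage hf).isCompact
  have : NormalSpace (partition U) := hP.isClosedEmbedding_subtypeVal.normalSpace
  have hg : Continuous g := by fun_prop
  have hgi : g.Injective := fun a b hab =>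
    Subtype.ext (hi (congrArg Subtype.val hab))
  rcases hUα with hE | ⟨β, hβ, hβU⟩
  · exact Or.inl (Function.isEmpty g)
  · exact Or.inr ⟨β, hβ, ih β hβ hg hgi hβU⟩

theorem KIndLT.of_injective {α : Ordinal.{u}} [CompactSpace Y] [T2Space X] [NormalSpace X]
    {f : Y → X} (hf : Continuous f) (hi : f.Injective) (h : KIndLT K α X) : KIndLT K α Y := by
  rcases h with hE | ⟨β, hβ, h⟩
  · exact Or.inl (Function.isEmpty f)
  · exact Or.inr ⟨β, hβ, h.of_injective hf hi⟩

/-- Finitely many spaces of dimension less than `α` have a common bound `β < α`, unless all of them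
are empty. -/
theorem exists_uniform_of_kIndLT {J : Type*} [Finite J] {Q : J → Type u}
    [∀ j, TopologicalSpace (Q j)] {α : Ordinal.{u}} (h : ∀ j, KIndLT K α (Q j)) :
    (∀ j, IsEmpty (Q j)) ∨ ∃ β < α, ∀ j, KIndLE K β (Q j) := by
  cases nonempty_fintype J
  rcases eq_or_ne α 0 with rfl | hα
  · exact Or.inl fun j => (h j).resolve_right fun ⟨β, hβ, _⟩ => absurd hβ not_lt_zero
  · have h' : ∀ j, ∃ β < α, KIndLE K β (Q j) := fun j => by
      rcases h j with hE | h
      · exact ⟨0, pos_iff_ne_zero.2 hα, .of_isEmpty 0⟩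
      · exact h
    choose β hβ hQ using h'
    refine Or.inr ⟨Finset.univ.sup β, ?_, fun j => (hQ j).mono (Finset.le_sup (Finset.mem_univ j))⟩
    exact (Finset.sup_lt_iff (pos_iff_ne_zero.2 hα)).2 fun j _ => hβ j

/-- Finite sum theorem: `X` is the disjoint union of the open-and-closed fibres of `c`. -/
theorem KIndLE.of_fibers {J : Type*} [Finite J] [TopologicalSpace J] [DiscreteTopology J]
    {α : Ordinal.{u}} [CompactSpace X] [T2Space X] {c : X → J} (hc : Continuous c)
    (h : ∀ j, KIndLE K α {x // c x = j}) : KIndLE K α X := by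
  induction α using WellFoundedLT.induction generalizing X with
  | ind α ih =>
  simp only [kIndLE_iff (α := α)] at h ⊢
  intro F hF
  choose U hU hUα using fun j => h j _
    (hF.preimage (continuous_subtype_val (p := fun x => c x = j)))
  have ho : ∀ j, IsOpen {x | c x = j} := fun j => (isOpen_discrete {j}).preimage hc
  set V : Fin (k + 1) → Set X := fun i => ⋃ j, Subtype.val '' U j i with hV
  have hVU : ∀ i x, x ∈ V i ↔ ⟨x, rfl⟩ ∈ U (c x) i := by
    intro i x
    simp only [hV, mem_iUnion]
    constructor
    · rintro ⟨j, ⟨y, rfl⟩, hy, rfl⟩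
      exact hy
    · exact fun hx => ⟨c x, _, hx, rfl⟩
  have hVo : ∀ i, IsOpen (V i) := fun i =>
    isOpen_iUnion fun j => (ho j).isOpenMap_subtype_val _ ((hU j).1.1 i)
  refine ⟨V, ⟨⟨hVo, isKTuple_iff.2 fun x I hI hx => ?_⟩, fun i x hx => ?_⟩, ?_⟩
  · exact isKTuple_iff.1 (hU (c x)).1.2 ⟨x, rfl⟩ I hI fun i hi => (hVU i x).1 (hx i hi)
  · exact (hVU i x).2 ((hU (c x)).2 i hx)
  · have : CompactSpace (partition V) :=
      isCompact_iff_compactSpace.1 (isClosed_partition hVo).isCompact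
    have hcV : Continuous fun x : partition V => c x := hc.comp continuous_subtype_val
    have hmem : ∀ j (x : {x : partition V // c x = j}),
        (⟨x.1.1, x.2⟩ : {x // c x = j}) ∈ partition (U j) := by
      rintro _ ⟨⟨x, hx⟩, rfl⟩
      rw [mem_partition] at hx ⊢
      exact fun i hi => hx i ((hVU i x).2 hi)
    rcases exists_uniform_of_kIndLT hUα with hE | ⟨β, hβ, hβU⟩
    · exact Or.inl ⟨fun x => (hE (c x)).false ⟨_, hmem _ ⟨x, rfl⟩⟩⟩
    · refine Or.inr ⟨β, hβ, ih β hβ hcV fun j => ?_⟩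
      have : CompactSpace {x : partition V // c x = j} :=
        isCompact_iff_compactSpace.1 ((isClosed_discrete {j}).preimage hcV).isCompact
      have : CompactSpace {x // c x = j} :=
        isCompact_iff_compactSpace.1 ((isClosed_discrete {j}).preimage hc).isCompact
      have : CompactSpace (partition (U j)) :=
        isCompact_iff_compactSpace.1 (isClosed_partition (hU j).1.1).isCompact
      refine (hβU j).of_injective (f := fun x => ⟨_, hmem j x⟩) (by fun_prop) fun a b hab => ?_
      simpa [Subtype.ext_iff] using hab

theorem KIndLT.of_fibers {J : Type*} [Finite J] [TopologicalSpace J] [DiscreteTopology J]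
    {α : Ordinal.{u}} [CompactSpace X] [T2Space X] {c : X → J} (hc : Continuous c)
    (h : ∀ j, KIndLT K α {x // c x = j}) : KIndLT K α X := by
  rcases exists_uniform_of_kIndLT h with hE | ⟨β, hβ, h⟩
  · exact Or.inl ⟨fun x => (hE (c x)).false ⟨x, rfl⟩⟩
  · exact Or.inr ⟨β, hβ, .of_fibers hc h⟩

end Dimension

/-! ### Products with zero-dimensional compact spaces -/

section Profinite

variable {S Y : Type u} [TopologicalSpace S] [CompactSpace S] [T2Space S]
  [TotallyDisconnectedSpace S] [TopologicalSpace Y]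

/-- A neighbourhood assignment on a zero-dimensional compact space can be made locally constant:
finitely many of the neighbourhoods contain the pieces of a partition into open-and-closed sets. -/
theorem exists_continuous_selection {O : S → Set S} (hO : ∀ s, IsOpen (O s)) (hs : ∀ s, s ∈ O s) :
    ∃ (n : ℕ) (c : S → Fin n) (r : Fin n → S), Continuous c ∧ ∀ s, s ∈ O (r (c s)) := by
  have hcov : TopologicalSpace.IsOpenCover fun s => (⟨O s, hO s⟩ : TopologicalSpace.Opens S) :=
    .mk (by ext x; simpa using ⟨x, hs x⟩)
  obtain ⟨n, W, hW, hWu, hWd⟩ := hcov.exists_finite_nonempty_disjoint_clopen_cover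
  choose r hr using fun j => (hW j).2
  choose c hc using fun s => mem_iUnion.1 (hWu (mem_univ s))
  refine ⟨n, c, r, continuous_discrete_rng.2 fun j => ?_, fun s => hr _ (hc s)⟩
  convert (W j).isOpen using 1
  ext s
  simp only [mem_preimage, mem_singleton_iff]
  refine ⟨fun h => h ▸ hc s, fun h => ?_⟩
  by_contra hne
  have := hWd hne
  exact (Set.disjoint_left.1 (TopologicalSpace.Clopens.coe_disjoint.2 this)) (hc s) h

/-- An open `K`-tuple without obstruction points on a zero-dimensional compact space can be
enlarged to an open `K`-tuple that covers the space. -/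
theorem exists_covering_of_dObs_eq_empty {U : Fin (k + 1) → Set S}
    (h : dObs K U = ∅) :
    ∃ T : Fin (k + 1) → Set S, IsKNhd K T U ∧ ∀ s, ∃ i, s ∈ T i := by
  choose V hV i hi using exists_of_dObs_eq_empty h
  obtain ⟨n, c, r, hc, hcr⟩ := exists_continuous_selection (O := fun s => V s (i s))
    (fun s => (hV s).1.1 _) hi
  -- On the piece with value `a` of `c` the new tuple is `V (r a)`.
  have hT : ∀ l, {s | s ∈ V (r (c s)) l} = ⋃ j, c ⁻¹' {j} ∩ V (r j) l := by
    intro l; ext s; simp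
  refine ⟨fun l => {s | s ∈ V (r (c s)) l}, ⟨⟨fun l => ?_, isKTuple_iff.2 fun s => ?_⟩,
    fun l s hs => (hV _).2 l hs⟩, fun s => ⟨_, hcr s⟩⟩
  · have := hT l
    beta_reduce
    rw [this]
    exact isOpen_iUnion fun j => ((isOpen_discrete {j}).preimage hc).inter ((hV _).1.1 l)
  · exact isKTuple_iff.1 (hV (r (c s))).1.2 s

/-- Multiplication by a zero-dimensional compact space `S` does not raise the dimension: a
neighbourhood in `Y` chosen over one point of `S` serves nearby points too, so that there is a
partition that is a finite disjoint union of sets `C × Q` with `C` open and closed in `S` and `Q` a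
partition in `Y`. -/
theorem KIndLE.prod_left [CompactSpace Y] [T2Space Y] {α : Ordinal.{u}} (h : KIndLE K α Y) :
    KIndLE K α (S × Y) := by
  induction α using WellFoundedLT.induction generalizing Y with
  | ind α ih =>
  rw [kIndLE_iff] at *
  intro F hF
  choose U hU hUα using fun s : S => h _ (hF.preimage (f := fun y : Y => (s, y)) (by fun_prop))
  -- `O s` consists of the points over which the tuple `U s` still contains the trace of `F`.
  set O : S → Set S := fun s => ⋂ i, (Prod.fst '' (F i ∩ Prod.snd ⁻¹' (U s i)ᶜ))ᶜ with hOdef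
  have hO : ∀ s, IsOpen (O s) := fun s => isOpen_iInter_of_finite fun i => by
    refine (IsCompact.isClosed ?_).isOpen_compl
    exact ((hF.1 i).inter (((hU s).1.1 i).isClosed_compl.preimage continuous_snd)).isCompact.image
      continuous_fst
  have hOmem : ∀ s t, t ∈ O s ↔ ∀ i y, (t, y) ∈ F i → y ∈ U s i := by
    intro s t
    simp [hOdef]
  obtain ⟨n, c, r, hc, hcr⟩ := exists_continuous_selection hO
    fun s => (hOmem s s).2 fun i y hy => (hU s).2 i hy
  set V : Fin (k + 1) → Set (S × Y) := fun i => {p | p.2 ∈ U (r (c p.1)) i} with hV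
  have hVo : ∀ i, IsOpen (V i) := by
    intro i
    have : V i = ⋃ j, (fun p : S × Y => c p.1) ⁻¹' {j} ∩ Prod.snd ⁻¹' U (r j) i := by
      ext p; simp [hV]
    rw [this]
    exact isOpen_iUnion fun j => ((isOpen_discrete {j}).preimage (hc.comp continuous_fst)).inter
      (((hU _).1.1 i).preimage continuous_snd)
  refine ⟨V, ⟨⟨hVo, isKTuple_iff.2 fun p => ?_⟩, fun i p hp => ?_⟩, ?_⟩
  · exact isKTuple_iff.1 (hU (r (c p.1))).1.2 p.2
  · exact (hOmem _ _).1 (hcr p.1) i p.2 hp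
  · have : CompactSpace (partition V) :=
      isCompact_iff_compactSpace.1 (isClosed_partition hVo).isCompact
    have hcV : Continuous fun p : partition V => c p.1.1 := by fun_prop
    refine KIndLT.of_fibers hcV fun j => ?_
    have : CompactSpace {p : partition V // c p.1.1 = j} :=
      isCompact_iff_compactSpace.1 ((isClosed_discrete {j}).preimage hcV).isCompact
    have : CompactSpace (partition (U (r j))) :=
      isCompact_iff_compactSpace.1 (isClosed_partition (hU (r j)).1.1).isCompact
    have hmem : ∀ p : {p : partition V // c p.1.1 = j}, p.1.1.2 ∈ partition (U (r j)) := by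
      rintro ⟨⟨p, hp⟩, rfl⟩
      rw [mem_partition] at hp ⊢
      exact hp
    rcases hUα (r j) with hE | ⟨β, hβ, hβU⟩
    · exact Or.inl ⟨fun p => hE.false ⟨_, hmem p⟩⟩
    · refine Or.inr ⟨β, hβ, (ih β hβ hβU).of_injective
        (f := fun p => (p.1.1.1, ⟨_, hmem p⟩)) (by fun_prop) fun a b hab => ?_⟩
      simp only [Prod.mk.injEq, Subtype.mk.injEq] at hab
      exact Subtype.ext (Subtype.ext (Prod.ext hab.1 hab.2))

end Profinite

/-! ### Spaces that split over a one-point compactification -/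

theorem isClopen_singleton_coe {D : Type u} [TopologicalSpace D] [DiscreteTopology D] (d : D) :
    IsClopen {(d : OnePoint D)} :=
  ⟨isClosed_singleton, by
    simpa using OnePoint.isOpenEmbedding_coe.isOpenMap {d} (isOpen_discrete _)⟩

/-- The structure of `Z(X, Y)` on which the dimension estimates rest. The space `Z` splits into the
open-and-closed pieces `index ⁻¹ {d}`, `d ∈ D`, and the closed piece `index ⁻¹ {∞}`, which is a copy
of `X`; the whole of `Z` retracts to this copy, and the retraction maps the `d`-th piece into a
zero-dimensional compact subset `slice d`. -/
structure Plank (D X Z : Type u) [TopologicalSpace D] [TopologicalSpace X]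
    [TopologicalSpace Z] where
  /-- The coordinate in `OnePoint D`. -/
  index : Z → OnePoint D
  /-- The coordinate in `X`. -/
  point : Z → X
  /-- The embedding of `X` onto the piece at infinity. -/
  incl : X → Z
  /-- A zero-dimensional compact set containing the `X`-coordinates of the `d`-th piece. -/
  slice : D → Set X
  continuous_index : Continuous index
  continuous_point : Continuous point
  continuous_incl : Continuous incl
  index_incl : ∀ x, index (incl x) = OnePoint.infty
  point_incl : ∀ x, point (incl x) = x
  incl_point : ∀ z, index z = OnePoint.infty → incl (point z) = z
  isCompact_slice : ∀ d, IsCompact (slice d)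
  totallyDisconnected_slice : ∀ d, TotallyDisconnectedSpace (slice d)
  point_mem : ∀ (d : D) z, index z = d → point z ∈ slice d

namespace Plank

variable {D X Z : Type u} [TopologicalSpace D] [TopologicalSpace X] [TopologicalSpace Z]
  (P : Plank D X Z)

/-- The piece of `Z` over `d`. -/
abbrev Fibre (d : D) : Type u := {z : Z // P.index z = d}

/-- The retraction `point` on the `d`-th piece, as a map to the slice. -/
def toSlice (d : D) (z : P.Fibre d) : P.slice d := ⟨P.point z, P.point_mem d z z.2⟩

theorem continuous_toSlice (d : D) : Continuous (P.toSlice d) :=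
  (P.continuous_point.comp continuous_subtype_val).subtype_mk _

/-- The tuple in `Z` that is `U` on the copy of `X` and `G d` on the `d`-th piece. -/
def glue (U : Fin (k + 1) → Set X) (G : ∀ d, Fin (k + 1) → Set (P.Fibre d)) (i : Fin (k + 1)) :
    Set Z :=
  {z | (P.index z = OnePoint.infty ∧ P.point z ∈ U i) ∨
    ∃ (d : D) (h : P.index z = d), (⟨z, h⟩ : P.Fibre d) ∈ G d i}

variable {P} {U : Fin (k + 1) → Set X} {G : ∀ d, Fin (k + 1) → Set (P.Fibre d)}

theorem mem_glue_infty {z : Z} (hz : P.index z = OnePoint.infty) (i : Fin (k + 1)) :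
    z ∈ P.glue U G i ↔ P.point z ∈ U i := by
  simp [glue, hz]

theorem mem_glue_coe {d : D} {z : Z} (hz : P.index z = d) (i : Fin (k + 1)) :
    z ∈ P.glue U G i ↔ (⟨z, hz⟩ : P.Fibre d) ∈ G d i := by
  constructor
  · rintro (⟨h, -⟩ | ⟨e, he, h⟩)
    · exact absurd (h.symm.trans hz) (OnePoint.infty_ne_coe d)
    · obtain rfl : e = d := OnePoint.coe_injective (he.symm.trans hz)
      exact h
  · exact fun h => Or.inr ⟨d, hz, h⟩

theorem isKTuple_glue (hU : IsKTuple K U) (hG : ∀ d, IsKTuple K (G d)) :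
    IsKTuple K (P.glue U G) := by
  refine isKTuple_iff.2 fun z I hI hz => ?_
  rcases h : P.index z with _ | d
  · exact isKTuple_iff.1 hU (P.point z) I hI fun i hi => (mem_glue_infty h i).1 (hz i hi)
  · exact isKTuple_iff.1 (hG d) ⟨z, h⟩ I hI fun i hi => (mem_glue_coe h i).1 (hz i hi)

variable [DiscreteTopology D]

variable (P) in
theorem isClopen_fibre (d : D) : IsClopen {z | P.index z = d} :=
  (isClopen_singleton_coe d).preimage P.continuous_index

/-- A glued tuple is open if over all but finitely many `d` it contains the preimage of `U`. -/
theorem isOpen_glue (hU : ∀ i, IsOpen (U i)) (hG : ∀ d i, IsOpen (G d i)) {E : Set D}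
    (hE : E.Finite) (hEG : ∀ d ∉ E, ∀ i (z : P.Fibre d), P.point z ∈ U i → z ∈ G d i)
    (i : Fin (k + 1)) : IsOpen (P.glue U G i) := by
  have : P.glue U G i = (P.point ⁻¹' U i \ ⋃ d ∈ E, {z | P.index z = d}) ∪
      ⋃ d, Subtype.val '' G d i := by
    ext z
    rcases h : P.index z with _ | d
    · rw [mem_glue_infty h]
      have h1 : ∀ d : D, P.index z ≠ d := fun d hd => OnePoint.infty_ne_coe d (h.symm.trans hd)
      simp [h1]
    · rw [mem_glue_coe h]
      constructor
      · exact fun hz => Or.inr (mem_iUnion.2 ⟨d, _, hz, rfl⟩)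
      · rintro (⟨hz, hzE⟩ | hz)
        · refine hEG d (fun hd => hzE ?_) i _ hz
          simp only [mem_iUnion]
          exact ⟨d, hd, h⟩
        · obtain ⟨e, ⟨_, he⟩, hze, rfl⟩ := mem_iUnion.1 hz
          obtain rfl : e = d := OnePoint.coe_injective (he.symm.trans h)
          exact hze
  rw [this]
  exact (((hU i).preimage P.continuous_point).sdiff
      (hE.isClosed_biUnion fun d _ => (P.isClopen_fibre d).isClosed)).union
    (isOpen_iUnion fun d => (P.isClopen_fibre d).isOpen.isOpenMap_subtype_val _ (hG d i))

variable [CompactSpace Z]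

/-- By compactness, a closed tuple in `Z` whose trace on `X` lies in `U` lies in the preimage of `U`
over all but finitely many `d`. -/
theorem finite_exceptional {F : Fin (k + 1) → Set Z} (hF : ∀ i, IsClosed (F i))
    (hU : ∀ i, IsOpen (U i)) (hFU : ∀ i, P.incl ⁻¹' F i ⊆ U i) :
    {d : D | ∃ i z, P.index z = d ∧ z ∈ F i ∧ P.point z ∉ U i}.Finite := by
  set C : Set (OnePoint D) := P.index '' ⋃ i, F i ∩ P.point ⁻¹' (U i)ᶜ with hC
  have hCc : IsClosed C := by
    refine (IsClosed.isCompact ?_).image P.continuous_index |>.isClosed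
    exact isClosed_iUnion_of_finite fun i =>
      (hF i).inter ((hU i).isClosed_compl.preimage P.continuous_point)
  have hinf : OnePoint.infty ∉ C := by
    rintro ⟨z, hz, h⟩
    obtain ⟨i, hzF, hzU⟩ := mem_iUnion.1 hz
    exact hzU (hFU i (by rwa [mem_preimage, P.incl_point z h]))
  refine (((OnePoint.isClosed_iff_of_notMem hinf).1 hCc).2.finite_of_discrete).subset ?_
  rintro d ⟨i, z, hz, hzF, hzU⟩
  exact ⟨z, mem_iUnion.2 ⟨i, hzF, hzU⟩, hz⟩

variable [T2Space Z] [CompactSpace X] [T2Space X]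

/-- The partition of a glued tuple is the disjoint union of the partition in `X` and of finitely
many of the partitions in the pieces. -/
theorem kIndLT_partition_glue {α : Ordinal.{u}} (hV : ∀ i, IsOpen (P.glue U G i))
    (hU : ∀ i, IsOpen (U i)) (hG : ∀ d i, IsOpen (G d i)) (hUα : KIndLT K α (partition U))
    (hGα : ∀ d, KIndLT K α (partition (G d))) {E : Set D} (hE : E.Finite)
    (hEG : ∀ d ∉ E, partition (G d) = ∅) : KIndLT K α (partition (P.glue U G)) := by
  -- `index` maps the partition to the finite, hence discrete, set `{∞} ∪ E`.
  set Q := partition (P.glue U G) with hQ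
  have hmem : ∀ z ∈ Q, P.index z ∈ insert OnePoint.infty ((↑) '' E : Set (OnePoint D)) := by
    intro z hz
    rw [hQ, mem_partition] at hz
    rcases h : P.index z with _ | d
    · exact mem_insert _ _
    · refine mem_insert_of_mem _ ⟨d, ?_, rfl⟩
      by_contra hd
      have : (⟨z, h⟩ : P.Fibre d) ∈ partition (G d) :=
        mem_partition.2 fun i hi => hz i ((mem_glue_coe h i).2 hi)
      simp [hEG d hd] at this
  have hfin : (insert OnePoint.infty ((↑) '' E : Set (OnePoint D))).Finite :=
    (hE.image _).insert _
  have : Finite (insert OnePoint.infty ((↑) '' E : Set (OnePoint D)) : Set (OnePoint D)) := hfin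
  have : CompactSpace Q := isCompact_iff_compactSpace.1 (isClosed_partition hV).isCompact
  have hc : Continuous fun z : Q =>
      (⟨P.index z, hmem z z.2⟩ : (insert OnePoint.infty ((↑) '' E) : Set (OnePoint D))) :=
    (P.continuous_index.comp continuous_subtype_val).subtype_mk _
  refine KIndLT.of_fibers hc ?_
  rintro ⟨j, hj⟩
  have : CompactSpace {z : Q // (⟨P.index z, hmem z z.2⟩ :
      (insert OnePoint.infty ((↑) '' E) : Set (OnePoint D))) = ⟨j, hj⟩} :=
    (isClosed_singleton.preimage hc).isClosedEmbedding_subtypeVal.compactSpace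
  rcases j with _ | d
  · have : CompactSpace (partition U) :=
      isCompact_iff_compactSpace.1 (isClosed_partition hU).isCompact
    have hidx : ∀ z : {z : Q // (⟨P.index z, hmem z z.2⟩ :
        (insert OnePoint.infty ((↑) '' E) : Set (OnePoint D))) = ⟨OnePoint.infty, hj⟩},
        P.index z.1 = OnePoint.infty := fun z => congrArg Subtype.val z.2
    refine hUα.of_injective (f := fun z => ⟨P.point z.1.1, mem_partition.2 fun i hi =>
      mem_partition.1 z.1.2 i ((mem_glue_infty (hidx z) i).2 hi)⟩)
      ((P.continuous_point.comp (by fun_prop)).subtype_mk _) fun a b hab => ?_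
    refine Subtype.ext (Subtype.ext ?_)
    rw [← P.incl_point _ (hidx a), ← P.incl_point _ (hidx b)]
    exact congrArg P.incl (congrArg Subtype.val hab)
  · have : CompactSpace (P.Fibre d) :=
      isCompact_iff_compactSpace.1 (P.isClopen_fibre d).isClosed.isCompact
    have : CompactSpace (partition (G d)) :=
      isCompact_iff_compactSpace.1 (isClosed_partition (hG d)).isCompact
    have hidx : ∀ z : {z : Q // (⟨P.index z, hmem z z.2⟩ :
        (insert OnePoint.infty ((↑) '' E) : Set (OnePoint D))) = ⟨OnePoint.some d, hj⟩},
        P.index z.1 = d := fun z => congrArg Subtype.val z.2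
    refine (hGα d).of_injective (f := fun z => ⟨⟨z.1.1, hidx z⟩, mem_partition.2 fun i hi =>
      mem_partition.1 z.1.2 i ((mem_glue_coe (hidx z) i).2 hi)⟩)
      (Continuous.subtype_mk (Continuous.subtype_mk (by fun_prop) _) _) fun a b hab => ?_
    refine Subtype.ext (Subtype.ext ?_)
    simpa only [Subtype.mk.injEq] using hab

end Plank

/-- Restriction to a subspace, and more generally pulling back, creates no obstruction points. -/
theorem dObs_preimage_eq_empty {X Y : Type u} [TopologicalSpace X] [TopologicalSpace Y]
    {U : Fin (k + 1) → Set X} (h : dObs K U = ∅) {f : Y → X} (hf : Continuous f) :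
    dObs K (fun i => f ⁻¹' U i) = ∅ := by
  refine eq_empty_of_forall_notMem fun y hy => hy ?_
  obtain ⟨V, hV, i, hi⟩ := exists_of_dObs_eq_empty h (f y)
  exact ⟨fun i => f ⁻¹' V i, ⟨hV.1.preimage hf, fun i => preimage_mono (hV.2 i)⟩,
    mem_iUnion.2 ⟨i, hi⟩⟩

namespace Plank

variable {D X Z : Type u} [TopologicalSpace D] [TopologicalSpace X] [TopologicalSpace Z]
  (P : Plank D X Z) [DiscreteTopology D] [CompactSpace Z] [T2Space Z] [CompactSpace X] [T2Space X]

/-- The upper estimate for the dimension. Where the closed tuple lies over the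
tuple `U` in `X`, the absence of obstruction points allows one to cover the whole zero-dimensional
slice; hence only finitely many pieces contribute to the partition. -/
theorem kIndLE {δ : Ordinal.{u}}
    (hX : ∀ F : Fin (k + 1) → Set X, IsClosedKTuple K F →
      ∃ U : Fin (k + 1) → Set X, IsKNhd K U F ∧ dObs K U = ∅ ∧ KIndLT K δ (partition U))
    (hP : ∀ d, KIndLE K δ (P.Fibre d)) : KIndLE K δ Z := by
  rw [kIndLE_iff]
  intro F hF
  obtain ⟨U, hU, hUo, hUδ⟩ := hX _ (hF.preimage P.continuous_incl)
  -- Over `d ∉ E` the preimage of `U` contains the given closed tuple.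
  set E : Set D := {d | ∃ i z, P.index z = d ∧ z ∈ F i ∧ P.point z ∉ U i} with hEdef
  have hE : E.Finite := finite_exceptional hF.1 hU.1.1 hU.2
  have hG : ∀ d, ∃ G : Fin (k + 1) → Set (P.Fibre d),
      IsKNhd K G (fun i => Subtype.val ⁻¹' F i) ∧ KIndLT K δ (partition G) ∧
      (d ∉ E → (∀ i (z : P.Fibre d), P.point z ∈ U i → z ∈ G i) ∧ partition G = ∅) := by
    intro d
    by_cases hd : d ∈ E
    · obtain ⟨G, hG, hGδ⟩ := kIndLE_iff.1 (hP d) _ (hF.preimage continuous_subtype_val)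
      exact ⟨G, hG, hGδ, fun h => absurd hd h⟩
    · have := isCompact_iff_compactSpace.1 (P.isCompact_slice d)
      have := P.totallyDisconnected_slice d
      obtain ⟨T, hT, hTc⟩ := exists_covering_of_dObs_eq_empty
        (dObs_preimage_eq_empty hUo (continuous_subtype_val (p := (· ∈ P.slice d))))
      have hUT : ∀ i (z : P.Fibre d), P.point z ∈ U i → z ∈ P.toSlice d ⁻¹' T i :=
        fun i z hz => hT.2 i hz
      have hempty : partition (fun i => P.toSlice d ⁻¹' T i) = ∅ := by
        refine eq_empty_of_forall_notMem fun z hz => ?_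
        obtain ⟨i, hi⟩ := hTc (P.toSlice d z)
        exact mem_partition.1 hz i hi
      refine ⟨fun i => P.toSlice d ⁻¹' T i, ⟨hT.1.preimage (P.continuous_toSlice d), ?_⟩,
        Or.inl (isEmpty_coe_sort.2 hempty), fun _ => ⟨hUT, hempty⟩⟩
      intro i z hz
      refine hUT i z ?_
      by_contra hzU
      exact hd ⟨i, z, z.2, hz, hzU⟩
  choose G hG hGδ hGE using hG
  have hV : ∀ i, IsOpen (P.glue U G i) :=
    isOpen_glue hU.1.1 (fun d => (hG d).1.1) hE fun d hd => (hGE d hd).1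
  refine ⟨P.glue U G, ⟨⟨hV, isKTuple_glue hU.1.2 fun d => (hG d).1.2⟩, fun i z hz => ?_⟩,
    kIndLT_partition_glue hV hU.1.1 (fun d => (hG d).1.1) hUδ hGδ hE fun d hd => (hGE d hd).2⟩
  rcases h : P.index z with _ | d
  · exact (mem_glue_infty h i).2 (hU.2 i (by rwa [mem_preimage, P.incl_point z h]))
  · exact (mem_glue_coe h i).2 ((hG d).2 i hz)

end Plank

/-! ### The boundary of a simplex -/

theorem mem_boundarySimplex_faces {hk : 1 ≤ k} {I : Finset (Fin (k + 1))} (hI : I.Nonempty)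
    {j : Fin (k + 1)} (hj : j ∉ I) : I ∈ (boundarySimplex k hk).faces := by
  have h : I ⊂ Finset.univ := Finset.ssubset_univ_iff.2 fun h => hj (by simp [h])
  exact ⟨hI, Nat.lt_succ_iff.1 (by simpa using Finset.card_lt_card h)⟩

theorem exists_notMem_of_isKTuple {X : Type u} {hk : 1 ≤ k} {A : Fin (k + 1) → Set X}
    (hA : IsKTuple (boundarySimplex k hk) A) (x : X) : ∃ j, x ∉ A j := by
  by_contra! h
  have := (isKTuple_iff.1 hA x Finset.univ Finset.univ_nonempty fun i _ => h i).2
  simp at this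

theorem fin_ne_add_one (hk : 1 ≤ k) (j : Fin (k + 1)) : j ≠ j + 1 := by
  obtain ⟨n, rfl⟩ := Nat.exists_eq_add_of_le' hk
  simp

theorem fin_ne_add_one_add_one (hk : 2 ≤ k) (j : Fin (k + 1)) : j ≠ j + 1 + 1 := by
  obtain ⟨n, rfl⟩ := Nat.exists_eq_add_of_le' hk
  intro h
  rw [add_assoc j 1 1] at h
  have h2 : 2 % (n + 2 + 1) = 0 := by simpa [Fin.ext_iff, Fin.val_add] using left_eq_add.1 h
  rw [Nat.mod_eq_of_lt (by omega)] at h2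
  exact two_ne_zero h2

/-- Covering a zero-dimensional compact space modulo `∂Δᵏ`: near each point choose an index `j`
with the point outside `B j`, and add the uncovered points to the member with the next index
`j + 1`. -/
theorem exists_cyclic_covering {S : Type u} [TopologicalSpace S] [CompactSpace S] [T2Space S]
    [TotallyDisconnectedSpace S] {hk : 1 ≤ k} {U B : Fin (k + 1) → Set S}
    (hU : ∀ i, IsOpen (U i)) (hB : IsClosedKTuple (boundarySimplex k hk) B) :
    ∃ T : Fin (k + 1) → Set S, (∀ i, IsOpen (T i)) ∧ (∀ i, U i ⊆ T i) ∧ (∀ s, ∃ i, s ∈ T i) ∧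
      ∀ s, ∃ j, s ∉ B j ∧ ∀ l, s ∈ T l → s ∈ U l ∨ l = j + 1 := by
  choose j hj using exists_notMem_of_isKTuple hB.2
  obtain ⟨n, c, r, hc, hcr⟩ := exists_continuous_selection (O := fun s => (B (j s))ᶜ)
    (fun s => (hB.1 _).isOpen_compl) hj
  refine ⟨fun l => U l ∪ {s | l = j (r (c s)) + 1}, fun l => (hU l).union ?_,
    fun l => subset_union_left, fun s => ⟨_, Or.inr rfl⟩, fun s => ⟨j (r (c s)), hcr s,
    fun l hl => hl⟩⟩
  exact (isOpen_discrete {a | l = j (r a) + 1}).preimage hc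

namespace Plank

variable {D X Z : Type u} [TopologicalSpace D] [TopologicalSpace X] [TopologicalSpace Z]
  (P : Plank D X Z) [DiscreteTopology D] [CompactSpace Z] [T2Space Z] [CompactSpace X] [T2Space X]

/-- Modulo `∂Δᵏ`, `k ≥ 2`, closed tuples have neighbourhoods without obstruction points and with
partitions of dimension at most `α`. A point `x` of `X` outside `B j` can be added to the member
with index `j + 1`: if that created a common point of all members in a piece, over a point of
the slice outside `B j'` that was possibly added to the member with index `j' + 1`, then
`j = j' + 1` and `j' = j + 1`, which is impossible modulo `k + 1 ≥ 3`. -/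
theorem exists_nhd_dObs_eq_empty (hk : 2 ≤ k) {hk' : 1 ≤ k} {α : Ordinal.{u}}
    (hX : KIndLE (boundarySimplex k hk') α X)
    (hP : ∀ d, KIndLE (boundarySimplex k hk') α (P.Fibre d)) {F : Fin (k + 1) → Set Z}
    (hF : IsClosedKTuple (boundarySimplex k hk') F) :
    ∃ V : Fin (k + 1) → Set Z, IsKNhd (boundarySimplex k hk') V F ∧
      dObs (boundarySimplex k hk') V = ∅ ∧
      KIndLT (boundarySimplex k hk') (Order.succ α) (partition V) := by
  obtain ⟨B, hB, hFB⟩ := exists_closed_swelling hF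
  set U : Fin (k + 1) → Set X := fun i => P.incl ⁻¹' interior (B i) with hUdef
  have hU : ∀ i, IsOpen (U i) := fun i => isOpen_interior.preimage P.continuous_incl
  have hUB : ∀ i, U i ⊆ P.incl ⁻¹' B i := fun i => preimage_mono interior_subset
  have hBX := hB.preimage P.continuous_incl
  have hUK : IsKTuple (boundarySimplex k hk') U := hBX.2.mono hUB
  -- Over `d ∉ E` the preimage of `U` contains the given closed tuple.
  set E : Set D := {d | ∃ i z, P.index z = d ∧ z ∈ F i ∧ P.point z ∉ U i} with hEdef
  have hE : E.Finite := finite_exceptional hF.1 hU fun i => preimage_mono (hFB i)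
  have hFibre : ∀ d, CompactSpace (P.Fibre d) := fun d =>
    isCompact_iff_compactSpace.1 (P.isClopen_fibre d).isClosed.isCompact
  have hG : ∀ d, ∃ G : Fin (k + 1) → Set (P.Fibre d),
      IsKNhd (boundarySimplex k hk') G (fun i => Subtype.val ⁻¹' F i) ∧
      (d ∈ E → ∀ i, G i ⊆ Subtype.val ⁻¹' B i) ∧
      (d ∉ E → (∀ i (z : P.Fibre d), P.point z ∈ U i → z ∈ G i) ∧ (∀ z, ∃ i, z ∈ G i) ∧
        ∀ z : P.Fibre d, ∃ j, P.incl (P.point z) ∉ B j ∧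
          ∀ l, z ∈ G l → P.point z ∈ U l ∨ l = j + 1) := by
    intro d
    by_cases hd : d ∈ E
    · have hsub : ∀ i, (Subtype.val ⁻¹' interior (B i) : Set (P.Fibre d)) ⊆ Subtype.val ⁻¹' B i :=
        fun i => preimage_mono interior_subset
      exact ⟨fun i => Subtype.val ⁻¹' interior (B i),
        ⟨⟨fun i => isOpen_interior.preimage continuous_subtype_val,
          (hB.2.preimage Subtype.val).mono hsub⟩, fun i => preimage_mono (hFB i)⟩,
        fun _ => hsub, fun h => absurd hd h⟩
    · have := isCompact_iff_compactSpace.1 (P.isCompact_slice d)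
      have := P.totallyDisconnected_slice d
      obtain ⟨T, hTo, hUT, hTc, hT⟩ := exists_cyclic_covering
        (fun i => (hU i).preimage (continuous_subtype_val (p := (· ∈ P.slice d))))
        (hBX.preimage continuous_subtype_val)
      refine ⟨fun i => P.toSlice d ⁻¹' T i,
        ⟨⟨fun i => (hTo i).preimage (P.continuous_toSlice d), ?_⟩, fun i z hz => ?_⟩,
        fun h => absurd h hd, fun _ => ⟨fun i z hz => hUT i hz, fun z => hTc _,
          fun z => hT (P.toSlice d z)⟩⟩
      · refine IsKTuple.preimage (isKTuple_iff.2 fun s I hI hs => ?_) _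
        obtain ⟨j, hj, hjT⟩ := hT s
        refine mem_boundarySimplex_faces hI (j := j) fun hjI => ?_
        rcases hjT j (hs j hjI) with h | h
        · exact hj (hUB j h)
        · exact fin_ne_add_one hk' j h
      · refine hUT i ?_
        by_contra hzU
        exact hd ⟨i, z, z.2, hz, hzU⟩
  choose G hG hGE hGE' using hG
  have hVo : ∀ i, IsOpen (P.glue U G i) :=
    isOpen_glue hU (fun d => (hG d).1.1) hE fun d hd => (hGE' d hd).1
  have hV : IsOpenKTuple (boundarySimplex k hk') (P.glue U G) :=
    ⟨hVo, isKTuple_glue hUK fun d => (hG d).1.2⟩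
  refine ⟨P.glue U G, ⟨hV, fun i z hz => ?_⟩, eq_empty_of_forall_notMem fun z => ?_, ?_⟩
  · rcases h : P.index z with _ | d
    · refine (mem_glue_infty h i).2 ?_
      have := hFB i hz
      rwa [← P.incl_point z h] at this
    · exact (mem_glue_coe h i).2 ((hG d).2 i hz)
  · rcases h : P.index z with _ | d
    · obtain ⟨j, hj⟩ := exists_notMem_of_isKTuple hBX.2 (P.point z)
      refine notMem_dObs hV
        (O := P.point ⁻¹' (P.incl ⁻¹' B j)ᶜ \ ⋃ d ∈ E, {z | P.index z = d}) ?_ ?_ (j + 1) ?_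
      · exact ((hBX.1 j).isOpen_compl.preimage P.continuous_point).sdiff
          (hE.isClosed_biUnion fun d _ => (P.isClopen_fibre d).isClosed)
      · refine ⟨hj, ?_⟩
        have h1 : ∀ d : D, P.index z ≠ d := fun d hd => OnePoint.infty_ne_coe d (h.symm.trans hd)
        simp [h1]
      · rintro w ⟨hwB, hwE⟩ I hI hw
        have hwU : P.point w ∉ U j := fun hw => hwB (hUB j hw)
        rcases h' : P.index w with _ | d
        · refine mem_boundarySimplex_faces hI (j := j) fun hjI => ?_
          rcases hw j hjI with hw | hw
          · exact hwU ((mem_glue_infty h' j).1 hw)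
          · exact fin_ne_add_one hk' j hw
        · have hd : d ∉ E := fun hd => hwE (mem_biUnion hd h')
          obtain ⟨j', hj', hG'⟩ := (hGE' d hd).2.2 ⟨w, h'⟩
          by_contra hIK
          have hall : ∀ l, w ∈ P.glue U G l ∨ l = j + 1 := fun l =>
            hw l (by by_contra hl; exact hIK (mem_boundarySimplex_faces hI hl))
          have h1 : j = j' + 1 := by
            rcases hall j with hw | hw
            · exact (hG' j ((mem_glue_coe h' j).1 hw)).resolve_left hwU
            · exact absurd hw (fin_ne_add_one hk' j)
          have h2 : j' = j + 1 := by
            rcases hall j' with hw | hw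
            · rcases hG' j' ((mem_glue_coe h' j').1 hw) with hw | hw
              · exact absurd (hUB j' hw) hj'
              · exact absurd hw (fin_ne_add_one hk' j')
            · exact hw
          exact fin_ne_add_one_add_one hk j (by rw [← h2, ← h1])
    · by_cases hd : d ∈ E
      · refine notMem_dObs_of_subset_closed hV hB (P.isClopen_fibre d).isOpen h ?_
        rintro i w ⟨hw, hwd⟩
        exact hGE d hd i ((mem_glue_coe hwd i).1 hw)
      · obtain ⟨i, hi⟩ := (hGE' d hd).2.1 ⟨z, h⟩
        exact fun hz => hz ⟨P.glue U G, ⟨hV, fun _ => subset_rfl⟩,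
          mem_iUnion.2 ⟨i, (mem_glue_coe h i).2 hi⟩⟩
  · have := isCompact_iff_compactSpace.1 (isClosed_partition hU).isCompact
    refine kIndLT_partition_glue hVo hU (fun d => (hG d).1.1) ?_ (fun d => ?_) hE fun d hd => ?_
    · exact kIndLT_succ.2 (hX.of_injective continuous_subtype_val Subtype.val_injective)
    · have := isCompact_iff_compactSpace.1 (isClosed_partition (hG d).1.1).isCompact
      exact kIndLT_succ.2 ((hP d).of_injective continuous_subtype_val Subtype.val_injective)
    · refine eq_empty_of_forall_notMem fun z hz => ?_
      obtain ⟨i, hi⟩ := (hGE' d hd).2.1 z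
      exact mem_partition.1 hz i hi

end Plank

/-! ### Values of the dimension -/

section Values

variable {X : Type u} [TopologicalSpace X]

theorem kInd_eq_bot [h : IsEmpty X] : kInd K X = ⊥ := if_pos h

theorem kInd_le_coe_iff {α : Ordinal.{u}} :
    kInd K X ≤ ((α : WithTop Ordinal.{u}) : WithBot (WithTop Ordinal.{u})) ↔ KIndLE K α X := by
  unfold kInd
  split_ifs with h h'
  · exact iff_of_true bot_le (.of_isEmpty α)
  · rw [WithBot.coe_le_coe, WithTop.coe_le_coe]
    exact ⟨fun h => (csInf_mem (s := {α | KIndLE K α X}) h').mono h, fun h => csInf_le' h⟩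
  · refine iff_of_false (fun h => ?_) fun h => h' ⟨α, h⟩
    exact absurd (WithBot.coe_le_coe.1 h) (by simp)

theorem kInd_lt_coe_iff {α : Ordinal.{u}} :
    kInd K X < ((α : WithTop Ordinal.{u}) : WithBot (WithTop Ordinal.{u})) ↔ KIndLT K α X := by
  constructor
  · intro h
    by_cases hE : IsEmpty X
    · exact Or.inl hE
    · by_cases h' : ∃ β, KIndLE K β X
      · refine Or.inr ⟨_, ?_, csInf_mem (s := {β | KIndLE K β X}) h'⟩
        rw [kInd, if_neg hE, if_pos h', WithBot.coe_lt_coe, WithTop.coe_lt_coe] at h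
        exact h
      · rw [kInd, if_neg hE, if_neg h'] at h
        exact absurd h not_top_lt
  · rintro (hE | ⟨β, hβ, h⟩)
    · rw [kInd_eq_bot]
      exact WithBot.bot_lt_coe _
    · exact (kInd_le_coe_iff.2 h).trans_lt
        (WithBot.coe_lt_coe.2 (WithTop.coe_lt_coe.2 hβ))

theorem kInd_eq_top_or_coe [Nonempty X] : kInd K X = ⊤ ∨ ∃ α : Ordinal.{u},
    kInd K X = ((α : WithTop Ordinal.{u}) : WithBot (WithTop Ordinal.{u})) := by
  unfold kInd
  rw [if_neg (not_isEmpty_of_nonempty X)]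
  split_ifs with h
  · exact Or.inr ⟨_, rfl⟩
  · exact Or.inl rfl

theorem kInd_mono {Y : Type u} [TopologicalSpace Y] [CompactSpace Y] [CompactSpace X] [T2Space X]
    [Nonempty X] {f : Y → X} (hf : Continuous f) (hi : f.Injective) : kInd K Y ≤ kInd K X := by
  rcases kInd_eq_top_or_coe (K := K) (X := X) with h | ⟨α, h⟩
  · exact h ▸ le_top
  · rw [h]
    exact kInd_le_coe_iff.2 ((kInd_le_coe_iff.1 h.le).of_injective hf hi)

theorem withBot_coe_add_one (α : Ordinal.{u}) :
    ((α : WithTop Ordinal.{u}) : WithBot (WithTop Ordinal.{u})) + 1 =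
      ((Order.succ α : Ordinal.{u}) : WithTop Ordinal.{u}) := by
  rw [Order.succ_eq_add_one]
  rfl

/-- If `X` has finite or transfinite dimension `α` and strength degree `0`, then closed `K`-tuples
have `K`-neighbourhoods without obstruction points and with partitions of dimension less
than `α`. For `α = 0` the partitions are empty, which excludes obstruction points. -/
theorem exists_nhd_of_dstr_eq_zero {α : Ordinal.{u}}
    (hα : kInd K X = ((α : WithTop Ordinal.{u}) : WithBot (WithTop Ordinal.{u})))
    (h : dstr K X = 0) (F : Fin (k + 1) → Set X) (hF : IsClosedKTuple K F) :
    ∃ U : Fin (k + 1) → Set X, IsKNhd K U F ∧ dObs K U = ∅ ∧ KIndLT K α (partition U) := by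
  rcases eq_or_ne α 0 with rfl | h0
  · obtain ⟨U, hU, hU0⟩ := kIndLE_iff.1 (kInd_le_coe_iff.1 hα.le) F hF
    refine ⟨U, hU, dObs_eq_empty_of_partition hU.1 ?_, hU0⟩
    exact isEmpty_coe_sort.1 (hU0.resolve_right fun ⟨β, hβ, _⟩ => absurd hβ not_lt_zero)
  · have hpos : 0 < kInd K X := by
      rw [hα]
      exact WithBot.coe_lt_coe.2 (WithTop.coe_lt_coe.2 (pos_iff_ne_zero.2 h0))
    have htop : kInd K X < ⊤ := by
      rw [hα]
      exact WithBot.coe_lt_coe.2 (WithTop.coe_lt_top α)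
    have h' : ∀ F : Fin (k + 1) → Set X, IsClosedKTuple K F →
        ∃ U : Fin (k + 1) → Set X, IsKNhd K U F ∧ dObs K U = ∅ ∧
          kInd K (partition U) < kInd K X := by
      by_contra hn
      rw [dstr, if_pos ⟨hpos, htop, hn⟩] at h
      exact one_ne_zero h
    obtain ⟨U, hU, hUo, hUα⟩ := h' F hF
    exact ⟨U, hU, hUo, kInd_lt_coe_iff.1 (hα ▸ hUα)⟩

end Values

/-! ### The space `Z(X, Y)` -/

section ZSpace

variable {D X Y : Type u}

variable (D X Y) in
/-- The coordinate of the quotient in `OnePoint D`. -/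
def quotIndex : PlankQuotient D X Y → OnePoint D :=
  Quotient.lift Prod.fst fun p q h => by
    rcases h with rfl | ⟨h, h', -⟩
    · rfl
    · exact h.trans h'.symm

variable (D X Y) in
/-- The coordinate of the quotient in `X`. -/
def quotPoint : PlankQuotient D X Y → X :=
  Quotient.lift (fun p => p.2.1) fun p q h => by
    rcases h with rfl | ⟨-, -, h⟩
    · rfl
    · exact h

open Classical in
/-- The coordinate in `Y` over the index `d`, extended by a constant over the other indices. -/
noncomputable def quotCoord (d : D) (y₀ : Y) : PlankQuotient D X Y → Y :=
  Quotient.lift (fun p => if p.1 = d then p.2.2 else y₀) fun p q h => by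
    rcases h with rfl | ⟨h, h', -⟩
    · rfl
    · simp [h, h']

theorem quotCoord_mk (d : D) (y₀ : Y) (x : X) (y : Y) :
    quotCoord d y₀ (Quotient.mk (plankSetoid D X Y) ((d : OnePoint D), x, y)) = y :=
  if_pos rfl

variable [TopologicalSpace X] {φ : D → smallSets X}

variable (Y) in
theorem mk_mem_zSpace_iff {a : OnePoint D} {x : X} {y : Y} :
    Quotient.mk (plankSetoid D X Y) (a, x, y) ∈ zSpace Y φ ↔
      ∀ d : D, a = d → x ∈ (φ d : Set X) := by
  simp only [zSpace, plankSlice, mem_iUnion, mem_image, mem_ofPred_eq]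
  constructor
  · rintro ⟨b, ⟨a', x', y'⟩, ⟨rfl, h⟩, he⟩ d rfl
    rcases Quotient.exact he with h' | ⟨-, h', -⟩
    · cases h'
      exact h d rfl
    · exact absurd h'.symm (OnePoint.infty_ne_coe d)
  · exact fun h => ⟨a, _, ⟨rfl, h⟩, rfl⟩

variable [TopologicalSpace Y] [TopologicalSpace D]

theorem continuous_quotIndex : Continuous (quotIndex D X Y) :=
  continuous_fst.quotient_lift _

theorem continuous_quotPoint : Continuous (quotPoint D X Y) :=
  Continuous.quotient_lift (by fun_prop) _

variable [DiscreteTopology D]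

theorem continuous_quotCoord (d : D) (y₀ : Y) : Continuous (quotCoord (X := X) d y₀) := by
  classical
  refine Continuous.quotient_lift (continuous_if (fun p hp => ?_) (by fun_prop) (by fun_prop)) _
  have : IsClopen {p : OnePoint D × X × Y | p.1 = d} :=
    (isClopen_singleton_coe d).preimage continuous_fst
  simp [this.frontier_eq] at hp

instance [T2Space X] [T2Space Y] : T2Space (PlankQuotient D X Y) := by
  refine ⟨fun z z' hne => ?_⟩
  induction z using Quotient.inductionOn with | h p
  induction z' using Quotient.inductionOn with | h q
  obtain ⟨a, x, y⟩ := p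
  obtain ⟨b, x', y'⟩ := q
  by_cases hab : a = b
  · subst hab
    by_cases hx : x = x'
    · subst hx
      rcases a with _ | d
      · exact absurd (Quotient.sound (Or.inr ⟨rfl, rfl, rfl⟩)) hne
      · refine separated_by_continuous (continuous_quotCoord d y) fun h => hne ?_
        rw [(quotCoord_mk d y x y).symm.trans (h.trans (quotCoord_mk d y x y'))]
    · exact separated_by_continuous continuous_quotPoint hx
  · exact separated_by_continuous continuous_quotIndex hab

theorem isCompact_smallSet (S : smallSets X) : IsCompact (S : Set X) := by
  rcases S.2 with h | ⟨⟨e⟩⟩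
  · exact h.isCompact
  · exact isCompact_iff_compactSpace.2 e.symm.compactSpace

theorem totallyDisconnectedSpace_smallSet [T2Space X] (S : smallSets X) :
    TotallyDisconnectedSpace (S : Set X) := by
  rcases S.2 with h | ⟨⟨e⟩⟩
  · have : Finite (S : Set X) := h
    infer_instance
  · exact e.symm.totallyDisconnectedSpace

theorem isClosed_zSpace [T2Space X] : IsClosed (zSpace Y φ) := by
  rw [← isQuotientMap_quotient_mk'.isClosed_preimage]
  have : Quotient.mk (plankSetoid D X Y) ⁻¹' zSpace Y φ =
      ⋂ d : D, {p | p.1 = (d : OnePoint D)}ᶜ ∪ {p | p.2.1 ∈ (φ d : Set X)} := by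
    ext ⟨a, x, y⟩
    rw [mem_preimage, mk_mem_zSpace_iff]
    simp [imp_iff_not_or]
  refine this ▸ isClosed_iInter fun d => IsClosed.union ?_ ?_
  · exact ((isClopen_singleton_coe d).preimage continuous_fst).compl.isClosed
  · exact (isCompact_smallSet _).isClosed.preimage (by fun_prop)

variable [CompactSpace X] [T2Space X] [CompactSpace Y]

instance : CompactSpace (zSpace Y φ) :=
  isCompact_iff_compactSpace.1 isClosed_zSpace.isCompact

variable (Y φ) in
/-- `Z(X, Y)` as a space split over `OnePoint D`. -/
def zPlank (y₀ : Y) : Plank D X (zSpace Y φ) where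
  index z := quotIndex D X Y z
  point z := quotPoint D X Y z
  incl x := ⟨Quotient.mk _ (OnePoint.infty, x, y₀), (mk_mem_zSpace_iff Y).2 fun d h =>
    absurd h (OnePoint.infty_ne_coe d)⟩
  slice d := φ d
  continuous_index := continuous_quotIndex.comp continuous_subtype_val
  continuous_point := continuous_quotPoint.comp continuous_subtype_val
  continuous_incl := (continuous_quotient_mk'.comp (by fun_prop)).subtype_mk _
  index_incl _ := rfl
  point_incl _ := rfl
  incl_point := by
    rintro ⟨z, hz⟩ h
    induction z using Quotient.inductionOn with | h p
    exact Subtype.ext (Quotient.sound (Or.inr ⟨rfl, h, rfl⟩))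
  isCompact_slice d := isCompact_smallSet _
  totallyDisconnected_slice d := totallyDisconnectedSpace_smallSet _
  point_mem := by
    rintro d ⟨z, hz⟩ h
    induction z using Quotient.inductionOn with | h p
    exact (mk_mem_zSpace_iff Y).1 hz d h

variable [T2Space Y]

theorem kIndLE_fibre_zPlank (y₀ : Y) {α : Ordinal.{u}} (hY : KIndLE K α Y) (d : D) :
    KIndLE K α ((zPlank Y φ y₀).Fibre d) := by
  have := isCompact_iff_compactSpace.1 ((zPlank Y φ y₀).isCompact_slice d)
  have := (zPlank Y φ y₀).totallyDisconnected_slice d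
  have : CompactSpace ((zPlank Y φ y₀).Fibre d) :=
    isCompact_iff_compactSpace.1 ((zPlank Y φ y₀).isClopen_fibre d).isClosed.isCompact
  refine (hY.prod_left (S := (zPlank Y φ y₀).slice d)).of_injective
    (f := fun z => ((zPlank Y φ y₀).toSlice d z, quotCoord (X := X) d y₀ z.1.1))
    (((zPlank Y φ y₀).continuous_toSlice d).prodMk
      ((continuous_quotCoord d y₀).comp (by fun_prop))) ?_
  rintro ⟨⟨z, hz⟩, hzd⟩ ⟨⟨w, hw⟩, hwd⟩ h
  induction z using Quotient.inductionOn with | h p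
  induction w using Quotient.inductionOn with | h q
  obtain ⟨a, x, y⟩ := p
  obtain ⟨b, x', y'⟩ := q
  obtain rfl : a = (d : OnePoint D) := hzd
  obtain rfl : b = (d : OnePoint D) := hwd
  have hx : x = x' := congrArg Subtype.val (congrArg Prod.fst h)
  have hy : y = y' :=
    (quotCoord_mk d y₀ x y).symm.trans ((congrArg Prod.snd h).trans (quotCoord_mk d y₀ x' y'))
  subst hx hy
  rfl

theorem kInd_left_le_zSpace [Nonempty X] [Nonempty Y] : kInd K X ≤ kInd K (zSpace Y φ) := by
  have P := zPlank Y φ (Classical.arbitrary Y)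
  have : Nonempty (zSpace Y φ) := ⟨P.incl (Classical.arbitrary X)⟩
  exact kInd_mono P.continuous_incl (Function.LeftInverse.injective P.point_incl)

theorem kInd_right_le_zSpace {d : D} (hd : (φ d : Set X).Nonempty) :
    kInd K Y ≤ kInd K (zSpace Y φ) := by
  obtain ⟨x, hx⟩ := hd
  have hmem : ∀ y, Quotient.mk (plankSetoid D X Y) ((d : OnePoint D), x, y) ∈ zSpace Y φ :=
    fun y => (mk_mem_zSpace_iff Y).2 fun e he => by
      obtain rfl : d = e := OnePoint.coe_injective he
      exact hx
  rcases isEmpty_or_nonempty Y with hY | ⟨⟨y₀⟩⟩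
  · rw [kInd_eq_bot]
    exact bot_le
  have : Nonempty (zSpace Y φ) := ⟨⟨_, hmem y₀⟩⟩
  refine kInd_mono (f := fun y => ⟨_, hmem y⟩)
    ((continuous_quotient_mk'.comp (by fun_prop)).subtype_mk _) fun y y' h => ?_
  exact (quotCoord_mk d y₀ x y).symm.trans
    ((congrArg (quotCoord d y₀) (congrArg Subtype.val h)).trans (quotCoord_mk d y₀ x y'))

/-- Closed tuples in `X` have neighbourhoods without obstruction points, and
every partition in `X` has dimension at most that of `X`. -/
theorem kInd_zSpace_le [Nonempty X] [Nonempty Y] :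
    kInd K (zSpace Y φ) ≤ max (kInd K X + 1) (kInd K Y) := by
  rcases kInd_eq_top_or_coe (K := K) (X := X) with hX | ⟨α, hX⟩
  · rw [hX]
    exact le_max_of_le_left le_top
  rcases kInd_eq_top_or_coe (K := K) (X := Y) with hY | ⟨β, hY⟩
  · rw [hY]
    exact le_max_of_le_right le_top
  rw [hX, hY, withBot_coe_add_one, ← WithBot.coe_max, ← WithTop.coe_max, kInd_le_coe_iff]
  refine (zPlank Y φ (Classical.arbitrary Y)).kIndLE (fun F hF => ?_) fun d =>
    (kIndLE_fibre_zPlank _ (kInd_le_coe_iff.1 hY.le) d).mono (le_max_right _ _)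
  obtain ⟨B, hB, hFB⟩ := exists_closed_swelling hF
  have hU : IsOpenKTuple K fun i => interior (B i) :=
    ⟨fun i => isOpen_interior, hB.2.mono fun i => interior_subset⟩
  have := isCompact_iff_compactSpace.1 (isClosed_partition hU.1).isCompact
  refine ⟨_, ⟨hU, hFB⟩, eq_empty_of_forall_notMem fun x => notMem_dObs_of_subset_closed hU hB
    isOpen_univ (mem_univ x) fun i => inter_subset_left.trans interior_subset,
    (kIndLT_succ.2 ?_).mono (le_max_left _ _)⟩
  exact (kInd_le_coe_iff.1 hX.le).of_injective continuous_subtype_val Subtype.val_injective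

/-- Strength degree `0` saves the summand `1`. -/
theorem kInd_zSpace_le_of_dstr_eq_zero [Nonempty X] [Nonempty Y] (h : dstr K X = 0) :
    kInd K (zSpace Y φ) ≤ max (kInd K X) (kInd K Y) := by
  rcases kInd_eq_top_or_coe (K := K) (X := X) with hX | ⟨α, hX⟩
  · rw [hX]
    exact le_max_of_le_left le_top
  rcases kInd_eq_top_or_coe (K := K) (X := Y) with hY | ⟨β, hY⟩
  · rw [hY]
    exact le_max_of_le_right le_top
  rw [hX, hY, ← WithBot.coe_max, ← WithTop.coe_max, kInd_le_coe_iff]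
  refine (zPlank Y φ (Classical.arbitrary Y)).kIndLE (fun F hF => ?_) fun d =>
    (kIndLE_fibre_zPlank _ (kInd_le_coe_iff.1 hY.le) d).mono (le_max_right _ _)
  obtain ⟨U, hU, hUo, hUα⟩ := exists_nhd_of_dstr_eq_zero hX h F hF
  exact ⟨U, hU, hUo, hUα.mono (le_max_left _ _)⟩

/-- Since `Z(X, Y)` has dimension one more than `X`, partitions of dimension at most that of `X`
suffice, and these can be found without obstruction points. -/
theorem dstr_zSpace_eq_zero [Nonempty X] [Nonempty Y] (hk : 2 ≤ k) {hk' : 1 ≤ k}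
    (hY : kInd (boundarySimplex k hk') Y < kInd (boundarySimplex k hk') X + 1)
    (hZ : kInd (boundarySimplex k hk') X + 1 = kInd (boundarySimplex k hk') (zSpace Y φ)) :
    dstr (boundarySimplex k hk') (zSpace Y φ) = 0 := by
  refine if_neg fun ⟨_, htop, h⟩ => h fun F hF => ?_
  rcases kInd_eq_top_or_coe (K := boundarySimplex k hk') (X := X) with hX | ⟨α, hX⟩
  · rw [← hZ, hX] at htop
    exact absurd htop (lt_irrefl ⊤)
  rw [hX, withBot_coe_add_one] at hY hZ
  obtain ⟨V, hV, hVo, hVα⟩ := (zPlank Y φ (Classical.arbitrary Y)).exists_nhd_dObs_eq_empty hk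
    (kInd_le_coe_iff.1 hX.le)
    (kIndLE_fibre_zPlank _ (kIndLT_succ.1 (kInd_lt_coe_iff.1 hY))) hF
  exact ⟨V, hV, hVo, hZ ▸ kInd_lt_coe_iff.2 hVα⟩

end ZSpace

end Fedorchuk

theorem mainTheorem5 (X Y D : Type u)
    [TopologicalSpace X] [CompactSpace X] [T2Space X] [Nonempty X]
    [TopologicalSpace Y] [CompactSpace Y] [T2Space Y] [Nonempty Y]
    [TopologicalSpace D] [DiscreteTopology D]
    (hD : ℵ₀ ≤ #D)
    (hX : Order.succ (Fedorchuk.weight X) ≤ #D)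
    (hY : Order.succ (Fedorchuk.weight Y) ≤ #D)
    (hS : #(Fedorchuk.smallSets X) ≤ #D)
    (φ : D → Fedorchuk.smallSets X)
    (hφ : ∀ S : Fedorchuk.smallSets X, #(φ ⁻¹' {S}) = #D) :
    (∀ (k : ℕ) (K : AbstractSimplicialComplex (Fin (k + 1))),
      Fedorchuk.kInd K (Fedorchuk.zSpace Y φ) ≤
          max (Fedorchuk.kInd K X + 1) (Fedorchuk.kInd K Y) ∧
        (Fedorchuk.dstr K X = 0 →
          Fedorchuk.kInd K (Fedorchuk.zSpace Y φ) =
            max (Fedorchuk.kInd K X) (Fedorchuk.kInd K Y))) ∧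
    (∀ (k : ℕ) (hk : 2 ≤ k),
      Fedorchuk.kInd (Fedorchuk.boundarySimplex k (one_le_two.trans hk)) Y <
          Fedorchuk.kInd (Fedorchuk.boundarySimplex k (one_le_two.trans hk)) X + 1 →
        Fedorchuk.kInd (Fedorchuk.boundarySimplex k (one_le_two.trans hk)) X + 1 =
          Fedorchuk.kInd (Fedorchuk.boundarySimplex k (one_le_two.trans hk))
            (Fedorchuk.zSpace Y φ) →
        Fedorchuk.dstr (Fedorchuk.boundarySimplex k (one_le_two.trans hk))
          (Fedorchuk.zSpace Y φ) = 0) := by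
  have hφ' : ∃ d, (φ d : Set X).Nonempty := by
    obtain ⟨x⟩ := ‹Nonempty X›
    have h : #(φ ⁻¹' {⟨{x}, Or.inl (finite_singleton x)⟩}) ≠ 0 := by
      rw [hφ]
      exact (aleph0_pos.trans_le hD).ne'
    obtain ⟨⟨d, hd⟩⟩ := mk_ne_zero_iff.1 h
    refine ⟨d, x, ?_⟩
    rw [mem_singleton_iff.1 hd]
    exact mem_singleton x
  obtain ⟨d, hd⟩ := hφ'
  refine ⟨fun k K => ⟨Fedorchuk.kInd_zSpace_le, fun h => le_antisymm
    (Fedorchuk.kInd_zSpace_le_of_dstr_eq_zero h)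
    (max_le Fedorchuk.kInd_left_le_zSpace (Fedorchuk.kInd_right_le_zSpace hd))⟩,
    fun k hk => Fedorchuk.dstr_zSpace_eq_zero hk⟩
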